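/- **Definitions.** A *generic configuration* $\xi=(L^\xi,\Delta_0^\xi,B^\xi,d,g)$ consists of the following. * $L^\xi$ is a first-order language with equality, containing $0,1,2,\le,\max$ with their usual meaning in the standard model $\mathbb N$ (in which the other symbols also have a fixed interpretation), and a closed term $T_k$ of value $k$ for each $k\in\mathbb N$. Formulae have, besides $\forall v$ and $\exists v$, the bounded quantifiers $\forall v\le t$ and $\exists v\le t$. * $\Delta_0^\xi$ is a class of formulae all of whose quantifiers are bounded. It contains the quantifier-free formulae and formulae defining the graphs of $+$ and $\cdot$ in $\mathbb N$, and it is closed under negation, conjunction, renaming of variables, and $\exists v\le w$ with $w$ a variable. A $\Pi_1^\xi$ (resp. $\Sigma_1^\xi$) formula is a $\Delta_0^\xi$ formula preceded by a (possibly empty) block of unbounded universal (resp. existential) quantifiers. * $B^\xi$ is a set of sentences that are true in $\mathbb N$, and every true $\Sigma_1^\xi$ sentence is provable from it. * $d$ is a deduction method (a relation "$P$ is a $d$-proof of $\varphi$ from $\alpha$"), monotone in the set $\alpha$ of axioms, which proves all axioms and all logically valid sentences and which, whenever it proves $X$, $Y$ and $(X\wedge Y)\to Z$ from $\alpha$,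 also proves $Z$ from $\alpha$. * $g$ is a Gödel numbering of formulae $\varphi\mapsto\lceil\varphi\rceil$ (injective on the formulae in each fixed number of free variables) and of proofs (injective) by natural numbers. A proof is identified with its number $p$ in $\mathrm{Log}(p)$. Write $\mathrm{Log}$ for $\log_2$, with $\mathrm{Log}(0)=-\infty$. A $\Pi_1^\xi$ or $\Sigma_1^\xi$ sentence is *Good*$(x)$ if it becomes true in $\mathbb N$ when its unbounded quantifiers are restricted to $v<2^x$. For a set $\theta$ of $\Pi_1^\xi$ sentences, $\sharp(\theta)$ is the largest $J\in\mathbb N$ such that all sentences in $\theta$ are Good$(J)$ ($\infty$ if there are arbitrarily large such $J$, and $-\infty$ if there is none). The configuration $\xi$ is *0-stable* (resp. *A-stable*, *E-stable*) if for each recursively enumerable set $\theta$ of $\Pi_1^\xi$ sentences and each $d$-proof $p$ from $\theta\cup B^\xi$ of a $\Delta_0^\xi$ (resp. $\Pi_1^\xi$, $\Sigma_1^\xi$) sentence $\Upsilon$ with $\mathrm{Log}(p)\le\sharp(\theta)+1$, the sentence $\Upsilon$ is true in $\mathbb N$ (resp. is Good$(\tfrac12\sharp(\theta))$, is Good$(\tfrac12\lfloor\mathrm{Log}(p)\rfloor-1)$,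 where $\lfloor\mathrm{Log}(0)\rfloor$ is read as $0$). Consider the following relations on $\mathbb N$. * $\mathrm{Neg}^0(x,y)$: $x=\lceil\Upsilon\rceil$ and $y=\lceil\neg\Upsilon\rceil$ for some $\Delta_0^\xi$ sentence $\Upsilon$. * $\mathrm{Prf}_\alpha(t,p)$: $p$ is the number of a $d$-proof from $\alpha$ of the sentence with number $t$. * $\mathrm{ExPrf}(h,t,p)$: $h=\lceil\eta\rceil$ for a sentence $\eta$ and $\mathrm{Prf}_{B^\xi\cup\{\eta\}}(t,p)$. * $\mathrm{Subst}(a,h)$: $a=\lceil\varphi\rceil$ for a formula $\varphi$ with one free variable and $h=\lceil\varphi(T_a)\rceil$. * $\mathrm{SubstPrf}(a,t,p)$: $\mathrm{Prf}_{B^\xi}(t,p)$, or $\mathrm{Subst}(a,h)\wedge\mathrm{ExPrf}(h,t,p)$ for some $h$. A *$\mathrm{SelfCons}^0(B^\xi,d)$ sentence* is a $\Pi_1^\xi$ sentence of the form $\Gamma(T_n)$ with $n=\lceil\Gamma\rceil$, where $$\Gamma(a)=\forall x\,\forall y\,\forall p\,\forall q\;\neg\{\mathrm{Neg}^0(x,y)\wedge\mathrm{SubstPrf}(a,x,p)\wedge\mathrm{SubstPrf}(a,y,q)\}$$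 is written with $\Delta_0^\xi$ formulae that define $\mathrm{Neg}^0$ and $\mathrm{SubstPrf}$ in $\mathbb N$. A $\Pi_1^\xi$ sentence *states the Level-0 consistency of $\alpha$* if it is $\forall x\,\forall y\,\forall p\,\forall q\;\neg\{\mathrm{Neg}^0(x,y)\wedge\mathrm{Prf}_\alpha(x,p)\wedge\mathrm{Prf}_\alpha(y,q)\}$, written with formulae that define $\mathrm{Neg}^0$ and $\mathrm{Prf}_\alpha$ in $\mathbb N$; it thus says that no $\Delta_0^\xi$ sentence and its negation are both provable from $\alpha$. An axiom system $\alpha$ is *consistent* if no sentence is provable from it together with its negation, and *self-justifying* if it is consistent and one of its theorems states its Level-0 consistency. The Gödel numbering is *conventional* if $\mathrm{Neg}^0$, $\mathrm{Prf}_{B^\xi}$, $\mathrm{ExPrf}$ and $\mathrm{Subst}$ are $\Delta_0$ relations on $\mathbb N$ (the least class containing the graphs of $+$ and $\cdot$ and closed under Boolean operations and quantification bounded by a variable), the number of a proof from $B^\xi\cup\{\eta\}$ that is not a proof from $B^\xi$ is at least $\lceil\eta\rceil$, and $\lceil\varphi\rceil\le\lceil\varphi(T_{\lceil\varphi\rceil})\rceil$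 for each formula $\varphi$ with one free variable. **Theorem.** Let $\xi$ be a generic configuration. 1. If the Gödel numbering is conventional, then a $\mathrm{SelfCons}^0(B^\xi,d)$ sentence exists. 2. If $\xi$ is A-stable or E-stable, then $\xi$ is 0-stable. 3. If $\xi$ is 0-stable, then for every $\mathrm{SelfCons}^0(B^\xi,d)$ sentence $\Phi$ the axiom system $B^\xi+\Phi$ is consistent, $\Phi$ states the Level-0 consistency of $B^\xi+\Phi$, and $B^\xi+\Phi$ is self-justifying. -/

import Mathlib

namespace SelfJust

open FirstOrder FirstOrder.Language

/-! ### Languages, formulae with bounded quantifiers, and their semantics -/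

/-- An arithmetical language: a first-order language with symbols for `0`, `1`, `2`, `≤` and maximum
(equality is built into the formulae), with its intended interpretation `std` over the natural
numbers (the model "Standard-M"), and with a closed term `num k` of value `k` for every `k`. -/
structure ArithLanguage where
  L : FirstOrder.Language.{0, 0}
  std : L.Structure ℕ
  zero : L.Functions 0
  one : L.Functions 0
  two : L.Functions 0
  max : L.Functions 2
  le : L.Relations 2
  zero_std : ∀ v, std.funMap zero v = 0
  one_std : ∀ v, std.funMap one v = 1
  two_std : ∀ v, std.funMap two v = 2
  max_std : ∀ v, std.funMap max v = Nat.max (v 0) (v 1)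
  le_std : ∀ v, std.RelMap le v ↔ v 0 ≤ v 1
  num : ℕ → L.Term Empty
  num_std : ∀ k, (letI := std; (num k).realize (Empty.elim : Empty → ℕ)) = k

instance (A : ArithLanguage) : A.L.Structure ℕ := A.std

/-- Formulae with free variables among `Fin n`.  Bounded quantifiers `∀ v ≤ t` and `∃ v ≤ t` are
primitive, so that they differ syntactically from the unbounded ones.  The variable bound by a
quantifier is the last one, `Fin.last n`; it does not occur in the bounding term `t`. -/
inductive Fml (A : ArithLanguage) : ℕ → Type
  | eq {n : ℕ} (s t : A.L.Term (Fin n)) : Fml A n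
  | rel {n k : ℕ} (R : A.L.Relations k) (ts : Fin k → A.L.Term (Fin n)) : Fml A n
  | neg {n : ℕ} (φ : Fml A n) : Fml A n
  | and {n : ℕ} (φ ψ : Fml A n) : Fml A n
  | or {n : ℕ} (φ ψ : Fml A n) : Fml A n
  | imp {n : ℕ} (φ ψ : Fml A n) : Fml A n
  | all {n : ℕ} (φ : Fml A (n + 1)) : Fml A n
  | ex {n : ℕ} (φ : Fml A (n + 1)) : Fml A n
  | ball {n : ℕ} (t : A.L.Term (Fin n)) (φ : Fml A (n + 1)) : Fml A n
  | bex {n : ℕ} (t : A.L.Term (Fin n)) (φ : Fml A (n + 1)) : Fml A n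

/-- Sentences: formulae without free variables. -/
abbrev Sentence (A : ArithLanguage) := Fml A 0

namespace Fml

variable {A : ArithLanguage}

/-- Truth in a structure `M`, where the unbounded quantifiers range over `D ⊆ M`.  The bounded
quantifiers are not affected by `D`.  Ordinary truth is the case `D = Set.univ`. -/
def Realize (M : Type) [A.L.Structure M] (D : Set M) : {n : ℕ} → Fml A n → (Fin n → M) → Prop
  | _, .eq s t, v => s.realize v = t.realize v
  | _, .rel R ts, v => Structure.RelMap R (fun i => (ts i).realize v)
  | _, .neg φ, v => ¬ φ.Realize M D v
  | _, .and φ ψ, v => φ.Realize M D v ∧ ψ.Realize M D v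
  | _, .or φ ψ, v => φ.Realize M D v ∨ ψ.Realize M D v
  | _, .imp φ ψ, v => φ.Realize M D v → ψ.Realize M D v
  | _, .all φ, v => ∀ a ∈ D, φ.Realize M D (Fin.snoc v a)
  | _, .ex φ, v => ∃ a ∈ D, φ.Realize M D (Fin.snoc v a)
  | _, .ball t φ, v =>
      ∀ a : M, Structure.RelMap A.le ![a, t.realize v] → φ.Realize M D (Fin.snoc v a)
  | _, .bex t φ, v =>
      ∃ a : M, Structure.RelMap A.le ![a, t.realize v] ∧ φ.Realize M D (Fin.snoc v a)

/-- All quantifiers of the formula are bounded. -/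
def FullyBounded : {n : ℕ} → Fml A n → Prop
  | _, .eq _ _ => True
  | _, .rel _ _ => True
  | _, .neg φ => φ.FullyBounded
  | _, .and φ ψ => φ.FullyBounded ∧ ψ.FullyBounded
  | _, .or φ ψ => φ.FullyBounded ∧ ψ.FullyBounded
  | _, .imp φ ψ => φ.FullyBounded ∧ ψ.FullyBounded
  | _, .all _ => False
  | _, .ex _ => False
  | _, .ball _ φ => φ.FullyBounded
  | _, .bex _ φ => φ.FullyBounded

/-- The formula has no quantifiers at all. -/
def QuantifierFree : {n : ℕ} → Fml A n → Prop
  | _, .eq _ _ => True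
  | _, .rel _ _ => True
  | _, .neg φ => φ.QuantifierFree
  | _, .and φ ψ => φ.QuantifierFree ∧ ψ.QuantifierFree
  | _, .or φ ψ => φ.QuantifierFree ∧ ψ.QuantifierFree
  | _, .imp φ ψ => φ.QuantifierFree ∧ ψ.QuantifierFree
  | _, .all _ => False
  | _, .ex _ => False
  | _, .ball _ _ => False
  | _, .bex _ _ => False

/-- A substitution, extended to the scope of a quantifier. -/
def liftSubst {n m : ℕ} (σ : Fin n → A.L.Term (Fin m)) : Fin (n + 1) → A.L.Term (Fin (m + 1)) :=
  Fin.snoc (α := fun _ => A.L.Term (Fin (m + 1)))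
    (fun i => (σ i).relabel Fin.castSucc) (Term.var (Fin.last m))

/-- Simultaneous capture-avoiding substitution of terms for the free variables. -/
def subst : {n m : ℕ} → Fml A n → (Fin n → A.L.Term (Fin m)) → Fml A m
  | _, _, .eq s t, σ => .eq (s.subst σ) (t.subst σ)
  | _, _, .rel R ts, σ => .rel R (fun i => (ts i).subst σ)
  | _, _, .neg φ, σ => .neg (φ.subst σ)
  | _, _, .and φ ψ, σ => .and (φ.subst σ) (ψ.subst σ)
  | _, _, .or φ ψ, σ => .or (φ.subst σ) (ψ.subst σ)
  | _, _, .imp φ ψ, σ => .imp (φ.subst σ) (ψ.subst σ)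
  | _, _, .all φ, σ => .all (φ.subst (liftSubst σ))
  | _, _, .ex φ, σ => .ex (φ.subst (liftSubst σ))
  | _, _, .ball t φ, σ => .ball (t.subst σ) (φ.subst (liftSubst σ))
  | _, _, .bex t φ, σ => .bex (t.subst σ) (φ.subst (liftSubst σ))

/-- Renaming (possibly with identification) of the free variables. -/
def rename {n m : ℕ} (φ : Fml A n) (f : Fin n → Fin m) : Fml A m :=
  φ.subst (fun i => Term.var (f i))

/-- The sentence `φ(T_k)`, where `T_k` is the closed term that names `k`. -/
def instNum (φ : Fml A 1) (k : ℕ) : Sentence A :=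
  φ.subst (fun _ => (A.num k).relabel Empty.elim)

/-- Truth of a sentence in the standard model. -/
def TrueStd (φ : Sentence A) : Prop := φ.Realize ℕ Set.univ Fin.elim0

/-- Logical validity: truth in every non-empty structure. -/
def Valid (φ : Sentence A) : Prop :=
  ∀ (M : Type) [Nonempty M] [A.L.Structure M], φ.Realize M Set.univ Fin.elim0

/-- `φ` defines the relation `R` in the standard model. -/
def Defines {n : ℕ} (φ : Fml A n) (R : (Fin n → ℕ) → Prop) : Prop :=
  ∀ v, φ.Realize ℕ Set.univ v ↔ R v

end Fml

/-! ### Generic configurations -/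

/-- `Π₁` formulae over a class `Δ` of formulae: a block, possibly empty, of unbounded universal
quantifiers in front of a formula in `Δ`. -/
inductive IsPi1 {A : ArithLanguage} (Δ : ∀ n, Set (Fml A n)) : {n : ℕ} → Fml A n → Prop
  | base {n : ℕ} {φ : Fml A n} : φ ∈ Δ n → IsPi1 Δ φ
  | all {n : ℕ} {φ : Fml A (n + 1)} : IsPi1 Δ φ → IsPi1 Δ (Fml.all φ)

/-- `Σ₁` formulae over a class `Δ` of formulae. -/
inductive IsSigma1 {A : ArithLanguage} (Δ : ∀ n, Set (Fml A n)) : {n : ℕ} → Fml A n → Prop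
  | base {n : ℕ} {φ : Fml A n} : φ ∈ Δ n → IsSigma1 Δ φ
  | ex {n : ℕ} {φ : Fml A (n + 1)} : IsSigma1 Δ φ → IsSigma1 Δ (Fml.ex φ)

/-- A generic configuration `(L, Δ₀, B, d, g)`. -/
structure GenericConfiguration where
  /-- The language. -/
  lang : ArithLanguage
  /-- The class of `Δ₀` formulae: a class of fully bounded formulae that contains the
  quantifier-free ones, is closed under negation, conjunction, renaming of variables and
  quantifiers bounded by variables, and contains definitions of the graphs of `+` and `*`. -/
  Δ₀ : ∀ n, Set (Fml lang n)
  Δ₀_bounded : ∀ {n : ℕ} {φ : Fml lang n}, φ ∈ Δ₀ n → φ.FullyBounded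
  Δ₀_quantifierFree : ∀ {n : ℕ} {φ : Fml lang n}, φ.QuantifierFree → φ ∈ Δ₀ n
  Δ₀_neg : ∀ {n : ℕ} {φ : Fml lang n}, φ ∈ Δ₀ n → φ.neg ∈ Δ₀ n
  Δ₀_and : ∀ {n : ℕ} {φ ψ : Fml lang n}, φ ∈ Δ₀ n → ψ ∈ Δ₀ n → φ.and ψ ∈ Δ₀ n
  Δ₀_rename : ∀ {n m : ℕ} {φ : Fml lang n} (f : Fin n → Fin m), φ ∈ Δ₀ n → φ.rename f ∈ Δ₀ m
  Δ₀_bex : ∀ {n : ℕ} {φ : Fml lang (n + 1)} (i : Fin n),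
    φ ∈ Δ₀ (n + 1) → Fml.bex (Term.var i) φ ∈ Δ₀ n
  Δ₀_add : ∃ φ ∈ Δ₀ 3, φ.Defines (fun v => v 0 + v 1 = v 2)
  Δ₀_mul : ∃ φ ∈ Δ₀ 3, φ.Defines (fun v => v 0 * v 1 = v 2)
  /-- The base axiom system. -/
  B : Set (Sentence lang)
  /-- The deduction method: its proofs, and the relation "`P` is a proof of `φ` from the axioms
  `α`".  Provability extends axiomhood and logical validity, is monotone in the axioms, and has the
  indirect-implication property. -/
  Proof : Type
  derives : Set (Sentence lang) → Proof → Sentence lang → Prop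
  derives_mono : ∀ {α β : Set (Sentence lang)} {P : Proof} {φ : Sentence lang},
    α ⊆ β → derives α P φ → derives β P φ
  derives_axiom : ∀ {α : Set (Sentence lang)} {φ : Sentence lang}, φ ∈ α → ∃ P, derives α P φ
  derives_valid : ∀ {α : Set (Sentence lang)} {φ : Sentence lang}, φ.Valid → ∃ P, derives α P φ
  derives_indirect : ∀ {α : Set (Sentence lang)} {φ ψ χ : Sentence lang},
    (∃ P, derives α P φ) → (∃ P, derives α P ψ) → (∃ P, derives α P ((φ.and ψ).imp χ)) →
      ∃ P, derives α P χ
  /-- The Gödel numbering of the formulae and of the proofs. -/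
  code : ∀ {n : ℕ}, Fml lang n → ℕ
  code_injective : ∀ n : ℕ, Function.Injective (code (n := n))
  g : Proof → ℕ
  g_injective : Function.Injective g
  /-- The base axioms are true in the standard model, and prove every true `Σ₁` sentence. -/
  B_true : ∀ φ ∈ B, φ.TrueStd
  B_sigma1_complete : ∀ φ : Sentence lang, IsSigma1 Δ₀ φ → φ.TrueStd → ∃ P, derives B P φ

/-- `Log v`: the base-two logarithm, with `Log 0 = -∞`. -/
noncomputable def Log (v : ℕ) : EReal :=
  if v = 0 then ⊥ else ((Real.logb 2 (v : ℝ) : ℝ) : EReal)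

/-- `Good(x)`: the sentence becomes true in the standard model when its unbounded quantifiers are
restricted to the numbers `v < 2 ^ x`, that is, `Log v < x`.  At `x = ∞` this is truth. -/
def Good {A : ArithLanguage} (x : EReal) (φ : Sentence A) : Prop :=
  φ.Realize ℕ {v | Log v < x} Fin.elim0

/-- `♯θ`: the largest `J` such that every sentence in `θ` is `Good(J)`; it is `∞` if there are
arbitrarily large such `J`, and `-∞` if there are none. -/
noncomputable def sharp {A : ArithLanguage} (θ : Set (Sentence A)) : EReal :=
  sSup {x | ∃ J : ℕ, x = ((J : ℝ) : EReal) ∧ ∀ φ ∈ θ, Good x φ}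

/-- The `Δ₀` relations on the natural numbers: the least class that contains the graphs of addition
and multiplication (in any variables), and is closed under negation, conjunction and
quantification bounded by a variable. -/
inductive IsDelta0Rel : {n : ℕ} → ((Fin n → ℕ) → Prop) → Prop
  | add {n : ℕ} (i j k : Fin n) : IsDelta0Rel (fun v => v i + v j = v k)
  | mul {n : ℕ} (i j k : Fin n) : IsDelta0Rel (fun v => v i * v j = v k)
  | not {n : ℕ} {R : (Fin n → ℕ) → Prop} : IsDelta0Rel R → IsDelta0Rel (fun v => ¬ R v)
  | and {n : ℕ} {R S : (Fin n → ℕ) → Prop} :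
      IsDelta0Rel R → IsDelta0Rel S → IsDelta0Rel (fun v => R v ∧ S v)
  | bex {n : ℕ} {R : (Fin (n + 1) → ℕ) → Prop} (i : Fin n) :
      IsDelta0Rel R → IsDelta0Rel (fun v => ∃ a ≤ v i, R (Fin.snoc v a))

namespace GenericConfiguration

variable (ξ : GenericConfiguration)

/-- `φ` is a theorem of the axiom system `α`. -/
def Provable (α : Set (Sentence ξ.lang)) (φ : Sentence ξ.lang) : Prop :=
  ∃ P, ξ.derives α P φ

/-- The axiom system `α` is consistent. -/
def Consistent (α : Set (Sentence ξ.lang)) : Prop :=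
  ¬ ∃ φ, ξ.Provable α φ ∧ ξ.Provable α φ.neg

/-! ### Stability -/

/-- `θ` is an R-view: a recursively enumerable set of `Π₁` sentences. -/
def IsRView (θ : Set (Sentence ξ.lang)) : Prop :=
  (∀ φ ∈ θ, IsPi1 ξ.Δ₀ φ) ∧ REPred (fun m : ℕ => ∃ φ ∈ θ, ξ.code φ = m)

def AStable : Prop :=
  ∀ θ, ξ.IsRView θ → ∀ (Υ : Sentence ξ.lang) (P : ξ.Proof), IsPi1 ξ.Δ₀ Υ →
    ξ.derives (θ ∪ ξ.B) P Υ → Log (ξ.g P) ≤ sharp θ + 1 → Good (sharp θ / 2) Υ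

/-- Here `Nat.log 2 p` is the integer part of `Log p`. -/
def EStable : Prop :=
  ∀ θ, ξ.IsRView θ → ∀ (Υ : Sentence ξ.lang) (P : ξ.Proof), IsSigma1 ξ.Δ₀ Υ →
    ξ.derives (θ ∪ ξ.B) P Υ → Log (ξ.g P) ≤ sharp θ + 1 →
      Good (((Nat.log 2 (ξ.g P) : ℝ) / 2 - 1 : ℝ) : EReal) Υ

def ZeroStable : Prop :=
  ∀ θ, ξ.IsRView θ → ∀ (Υ : Sentence ξ.lang) (P : ξ.Proof), Υ ∈ ξ.Δ₀ 0 →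
    ξ.derives (θ ∪ ξ.B) P Υ → Log (ξ.g P) ≤ sharp θ + 1 → Υ.TrueStd

/-! ### Arithmetization -/

/-- `Neg⁰(x, y)`: `x` is the Gödel number of a `Δ₀` sentence, and `y` that of its negation. -/
def NegRel (v : Fin 2 → ℕ) : Prop :=
  ∃ Υ ∈ ξ.Δ₀ 0, ξ.code Υ = v 0 ∧ ξ.code Υ.neg = v 1

/-- `Prf_α(t, p)`: `p` is the Gödel number of a proof from `α` of the sentence with Gödel
number `t`. -/
def PrfRel (α : Set (Sentence ξ.lang)) (v : Fin 2 → ℕ) : Prop :=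
  ∃ (φ : Sentence ξ.lang) (P : ξ.Proof), ξ.code φ = v 0 ∧ ξ.g P = v 1 ∧ ξ.derives α P φ

/-- `ExPrf(h, t, p)`: `p` is a proof of `t` from the base axioms together with the sentence whose
Gödel number is `h`. -/
def ExPrfRel (v : Fin 3 → ℕ) : Prop :=
  ∃ η : Sentence ξ.lang, ξ.code η = v 0 ∧ ξ.PrfRel (insert η ξ.B) ![v 1, v 2]

/-- `Subst(a, h)`: `a` is the Gödel number of a formula with one free variable, and `h` that of the
sentence which results from replacing this variable by the term that names `a`. -/
def SubstRel (v : Fin 2 → ℕ) : Prop :=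
  ∃ φ : Fml ξ.lang 1, ξ.code φ = v 0 ∧ ξ.code (φ.instNum (v 0)) = v 1

/-- `SubstPrf(a, t, p)`: `p` is a proof of `t` from the base axioms, or from the base axioms together
with the sentence `h` for which `Subst(a, h)` holds. -/
def SubstPrfRel (v : Fin 3 → ℕ) : Prop :=
  ξ.PrfRel ξ.B ![v 1, v 2] ∨ ∃ h, ξ.SubstRel ![v 0, h] ∧ ξ.ExPrfRel ![h, v 1, v 2]

/-- The sentence `∀ x y p q, ¬ (neg(x, y) ∧ prf(x, p) ∧ prf(y, q))`. -/
def consSentence {A : ArithLanguage} (neg prf : Fml A 2) : Sentence A :=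
  .all (.all (.all (.all (.neg
    (.and (.and (neg.rename ![(0 : Fin 4), 1]) (prf.rename ![(0 : Fin 4), 2]))
      (prf.rename ![(1 : Fin 4), 3]))))))

/-- The `Π₁` sentence `Φ` states that no `Δ₀` sentence and its negation are both provable
from `α`. -/
def StatesLevelZeroConsistency (α : Set (Sentence ξ.lang)) (Φ : Sentence ξ.lang) : Prop :=
  IsPi1 ξ.Δ₀ Φ ∧ ∃ neg prf : Fml ξ.lang 2,
    neg.Defines ξ.NegRel ∧ prf.Defines (ξ.PrfRel α) ∧ Φ = consSentence neg prf

/-- The axiom system `α` is self-justifying: it is consistent, and one of its theorems states its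
consistency. -/
def SelfJustifying (α : Set (Sentence ξ.lang)) : Prop :=
  (∃ Φ, ξ.Provable α Φ ∧ ξ.StatesLevelZeroConsistency α Φ) ∧ ξ.Consistent α

/-- The formula
`Γ(a) = ∀ x y p q, ¬ (neg(x, y) ∧ substPrf(a, x, p) ∧ substPrf(a, y, q))`. -/
def selfConsFormula {A : ArithLanguage} (neg : Fml A 2) (substPrf : Fml A 3) : Fml A 1 :=
  .all (.all (.all (.all (.neg
    (.and (.and (neg.rename ![(1 : Fin 5), 2]) (substPrf.rename ![(0 : Fin 5), 1, 3]))
      (substPrf.rename ![(0 : Fin 5), 2, 4]))))))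

/-- `Φ` is a `SelfCons⁰(B, d)` sentence: the `Π₁` sentence `Γ(T_k)`, where `k` is the Gödel number
of `Γ`, and `Γ` is built from `Δ₀` formulae that define `Neg⁰` and `SubstPrf`. -/
def IsSelfConsZero (Φ : Sentence ξ.lang) : Prop :=
  IsPi1 ξ.Δ₀ Φ ∧ ∃ neg ∈ ξ.Δ₀ 2, ∃ substPrf ∈ ξ.Δ₀ 3,
    neg.Defines ξ.NegRel ∧ substPrf.Defines ξ.SubstPrfRel ∧
      Φ = (selfConsFormula neg substPrf).instNum (ξ.code (selfConsFormula neg substPrf))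

/-- The Gödel numbering is conventional: the four basic syntactic relations on Gödel numbers are
`Δ₀` relations of natural numbers (equivalently, in the linear-time hierarchy), a proof is numbered
at least as high as an added axiom that it needs, and the self-substitution of a formula is numbered
at least as high as the formula. -/
structure ConventionalNumbering : Prop where
  neg_delta0 : IsDelta0Rel ξ.NegRel
  prf_delta0 : IsDelta0Rel (ξ.PrfRel ξ.B)
  exPrf_delta0 : IsDelta0Rel ξ.ExPrfRel
  subst_delta0 : IsDelta0Rel ξ.SubstRel
  axiom_le_proof : ∀ (η φ : Sentence ξ.lang) (P : ξ.Proof),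
    ξ.derives (insert η ξ.B) P φ → ξ.derives ξ.B P φ ∨ ξ.code η ≤ ξ.g P
  formula_le_subst : ∀ φ : Fml ξ.lang 1, ξ.code φ ≤ ξ.code (φ.instNum (ξ.code φ))

end GenericConfiguration

end SelfJust

/-! Self-reference is built into `SubstPrfRel`: at `a = ⌈Γ⌉` it speaks of proofs from `B` plus
`Γ(T_a)`, so `Γ(T_a)` is syntactically the sentence asserting the Level-0 consistency of `B` plus
itself (`selfConsFormula_instNum`, `substPrfRel_code`). No fixed-point lemma is needed.

Consistency is a least-counterexample argument. If `B + Φ` were inconsistent, it would prove some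
`Δ₀` sentence and its negation, so `Φ` would fail to be `Good(J)` for some natural `J`. At the least
such `J` there are proofs below `2 ^ J` of some `Δ₀` sentence `Υ` and of its negation, while `♯{Φ} ≥
J - 1`. Hence both proofs satisfy the bound `Log p ≤ ♯{Φ} + 1`, and 0-stability makes both `Υ` and
its negation true.

For existence, the conventions on numbering bound the quantifier over `h` in `SubstPrfRel` by the
proof `p`. The remaining difficulty is that `Δ₀` is closed under renaming of variables but need not
be closed under substitution of numerals. The parameter `a` is therefore confined to one equation,
which is quantifier-free after any substitution. -/

namespace SelfJust

open FirstOrder FirstOrder.Language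

/-! ### Substitution, its semantics, and numerals -/

namespace Fml

variable {A : ArithLanguage}

theorem term_relabel_subst {L : FirstOrder.Language.{0, 0}} {α β γ : Type} (t : L.Term α)
    (f : α → β) (σ : β → L.Term γ) : (t.relabel f).subst σ = t.subst (fun i => σ (f i)) := by
  induction t with
  | var => rfl
  | func F ts ih => simp only [Term.relabel, Term.subst, ih]

theorem term_subst_relabel {L : FirstOrder.Language.{0, 0}} {α β γ : Type} (t : L.Term α)
    (σ : α → L.Term β) (f : β → γ) :
    (t.subst σ).relabel f = t.subst (fun i => (σ i).relabel f) := by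
  induction t with
  | var => rfl
  | func F ts ih => simp only [Term.relabel, Term.subst, ih]

theorem term_subst_subst {L : FirstOrder.Language.{0, 0}} {α β γ : Type} (t : L.Term α)
    (σ : α → L.Term β) (τ : β → L.Term γ) :
    (t.subst σ).subst τ = t.subst (fun i => (σ i).subst τ) := by
  induction t with
  | var => rfl
  | func F ts ih => simp only [Term.subst, ih]

@[simp] theorem liftSubst_castSucc {n m : ℕ} (σ : Fin n → A.L.Term (Fin m)) (i : Fin n) :
    liftSubst σ i.castSucc = (σ i).relabel Fin.castSucc := by
  simp [liftSubst]

@[simp] theorem liftSubst_last {n m : ℕ} (σ : Fin n → A.L.Term (Fin m)) :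
    liftSubst σ (Fin.last n) = Term.var (Fin.last m) := by
  simp [liftSubst]

theorem liftSubst_subst {n m k : ℕ} (σ : Fin n → A.L.Term (Fin m))
    (τ : Fin m → A.L.Term (Fin k)) :
    (fun i => (liftSubst σ i).subst (liftSubst τ)) = liftSubst (fun i => (σ i).subst τ) := by
  funext i
  induction i using Fin.lastCases with
  | last => simp [Term.subst]
  | cast i => simp [term_relabel_subst, term_subst_relabel]

theorem subst_subst {n m k : ℕ} (φ : Fml A n) (σ : Fin n → A.L.Term (Fin m))
    (τ : Fin m → A.L.Term (Fin k)) :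
    (φ.subst σ).subst τ = φ.subst (fun i => (σ i).subst τ) := by
  induction φ generalizing m k with
  | eq | rel => simp only [subst, term_subst_subst]
  | neg _ ih => simp only [subst, ih]
  | and _ _ ih₁ ih₂ | or _ _ ih₁ ih₂ | imp _ _ ih₁ ih₂ => simp only [subst, ih₁, ih₂]
  | all _ ih | ex _ ih => simp only [subst, ih, liftSubst_subst]
  | ball _ _ ih | bex _ _ ih => simp only [subst, ih, liftSubst_subst, term_subst_subst]

theorem rename_subst {n m k : ℕ} (φ : Fml A n) (f : Fin n → Fin m)
    (τ : Fin m → A.L.Term (Fin k)) : (φ.rename f).subst τ = φ.subst (fun i => τ (f i)) :=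
  subst_subst _ _ _

theorem realize_liftSubst {M : Type} [A.L.Structure M] {n m : ℕ} (σ : Fin n → A.L.Term (Fin m))
    (v : Fin m → M) (a : M) :
    (fun i => (liftSubst σ i).realize (Fin.snoc v a : Fin (m + 1) → M)) =
      (Fin.snoc (fun i => (σ i).realize v) a : Fin (n + 1) → M) := by
  funext i
  induction i using Fin.lastCases with
  | last => simp
  | cast i =>
    simp only [liftSubst_castSucc, Term.realize_relabel, Fin.snoc_castSucc]
    congr 1
    funext j
    simp

theorem realize_subst {M : Type} [A.L.Structure M] (D : Set M) {n m : ℕ} (φ : Fml A n)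
    (σ : Fin n → A.L.Term (Fin m)) (v : Fin m → M) :
    (φ.subst σ).Realize M D v ↔ φ.Realize M D (fun i => (σ i).realize v) := by
  induction φ generalizing m with
  | eq | rel => simp only [subst, Realize, Term.realize_subst]
  | neg _ ih => simp only [subst, Realize, ih]
  | and _ _ ih₁ ih₂ | or _ _ ih₁ ih₂ | imp _ _ ih₁ ih₂ => simp only [subst, Realize, ih₁, ih₂]
  | all _ ih | ex _ ih => simp only [subst, Realize, ih, realize_liftSubst]
  | ball _ _ ih | bex _ _ ih =>
    simp only [subst, Realize, ih, realize_liftSubst, Term.realize_subst]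

theorem realize_rename {M : Type} [A.L.Structure M] (D : Set M) {n m : ℕ} (φ : Fml A n)
    (f : Fin n → Fin m) (v : Fin m → M) :
    (φ.rename f).Realize M D v ↔ φ.Realize M D (fun i => v (f i)) :=
  realize_subst _ _ _ _

/-- The truth of a fully bounded formula does not depend on the range of the unbounded
quantifiers. -/
theorem FullyBounded.realize_congr {M : Type} [A.L.Structure M] (D E : Set M) {n : ℕ}
    {φ : Fml A n} (h : φ.FullyBounded) (v : Fin n → M) :
    φ.Realize M D v ↔ φ.Realize M E v := by
  induction φ with
  | eq | rel => exact Iff.rfl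
  | neg _ ih => simp only [Realize, ih h]
  | and _ _ ih₁ ih₂ | or _ _ ih₁ ih₂ | imp _ _ ih₁ ih₂ => simp only [Realize, ih₁ h.1, ih₂ h.2]
  | all | ex => exact h.elim
  | ball _ _ ih | bex _ _ ih => simp only [Realize, ih h]

theorem FullyBounded.subst {n m : ℕ} {φ : Fml A n} (h : φ.FullyBounded)
    (σ : Fin n → A.L.Term (Fin m)) : (φ.subst σ).FullyBounded := by
  induction φ generalizing m with
  | eq | rel => trivial
  | neg _ ih => exact ih h _
  | and _ _ ih₁ ih₂ | or _ _ ih₁ ih₂ | imp _ _ ih₁ ih₂ => exact ⟨ih₁ h.1 _, ih₂ h.2 _⟩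
  | all | ex => exact h.elim
  | ball _ _ ih | bex _ _ ih => exact ih h _

/-- The term that names `k`, with free variables among `Fin n`. -/
def numeral (A : ArithLanguage) (n k : ℕ) : A.L.Term (Fin n) := (A.num k).relabel Empty.elim

theorem realize_numeral (n k : ℕ) (v : Fin n → ℕ) : (numeral A n k).realize v = k := by
  rw [numeral, Term.realize_relabel, Subsingleton.elim (v ∘ Empty.elim) Empty.elim]
  exact A.num_std k

theorem relabel_numeral {n m : ℕ} (k : ℕ) (f : Fin n → Fin m) :
    (numeral A n k).relabel f = numeral A m k := by
  rw [numeral, Term.relabel_relabel, Subsingleton.elim (f ∘ Empty.elim) Empty.elim, numeral]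

theorem subst_numeral {n m : ℕ} (k : ℕ) (σ : Fin n → A.L.Term (Fin m)) :
    (numeral A n k).subst σ = numeral A m k := by
  rw [numeral, term_relabel_subst, numeral]
  generalize A.num k = t
  induction t with
  | var i => exact i.elim
  | func F ts ih => simp only [Term.subst, Term.relabel, ih]

/-- The formula `φ(T_k, x, y)`. -/
def instFirst (φ : Fml A 3) (k : ℕ) : Fml A 2 :=
  φ.subst ![numeral A 2 k, Term.var 0, Term.var 1]

theorem Defines.rename {n m : ℕ} {φ : Fml A n} {R : (Fin n → ℕ) → Prop} (h : φ.Defines R)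
    (f : Fin n → Fin m) : (φ.rename f).Defines (fun v => R (fun i => v (f i))) :=
  fun _ => (realize_rename _ _ _ _).trans (h _)

theorem Defines.instFirst {φ : Fml A 3} {R : (Fin 3 → ℕ) → Prop} (h : φ.Defines R) (k : ℕ) :
    (φ.instFirst k).Defines (fun v => R ![k, v 0, v 1]) := by
  intro _
  rw [Fml.instFirst, realize_subst, h]
  apply iff_of_eq
  congr 1
  funext i
  fin_cases i
  · exact realize_numeral _ _ _
  · rfl
  · rfl

end Fml

/-! ### The diagonal sentence as a consistency sentence -/

open Fml

/-- A closed term passes unchanged under the four quantifiers. An identity of formulae is needed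
here, not mere equivalence, because stating consistency is a syntactic property. -/
theorem selfConsFormula_instNum {A : ArithLanguage} (neg : Fml A 2) (prf : Fml A 3) (k : ℕ) :
    (GenericConfiguration.selfConsFormula neg prf).instNum k =
      GenericConfiguration.consSentence neg (prf.instFirst k) := by
  -- Under four binders the parameter becomes the numeral and the bound variables keep their order,
  -- shifted down by one.
  have h0 : liftSubst (liftSubst (liftSubst (liftSubst (fun _ : Fin 1 => numeral A 0 k)))) =
      ![numeral A 4 k, Term.var 0, Term.var 1, Term.var 2, Term.var 3] := by
    funext i
    fin_cases i
    · simp [liftSubst, Fin.snoc, relabel_numeral]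
    all_goals rfl
  have h1 : ∀ i : Fin 2, (![numeral A 4 k, Term.var 0, Term.var 1, Term.var 2, Term.var 3] :
      Fin 5 → A.L.Term (Fin 4)) (![1, 2] i) = Term.var (![(0 : Fin 4), 1] i) := by
    intro i; fin_cases i <;> rfl
  have h2 : ∀ i : Fin 3, (![numeral A 4 k, Term.var 0, Term.var 1, Term.var 2, Term.var 3] :
      Fin 5 → A.L.Term (Fin 4)) (![0, 1, 3] i) =
      ((![numeral A 2 k, Term.var 0, Term.var 1] : Fin 3 → A.L.Term (Fin 2)) i).subst
        (fun i => Term.var (![(0 : Fin 4), 2] i)) := by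
    intro i; fin_cases i
    · exact (subst_numeral k _).symm
    · rfl
    · rfl
  have h3 : ∀ i : Fin 3, (![numeral A 4 k, Term.var 0, Term.var 1, Term.var 2, Term.var 3] :
      Fin 5 → A.L.Term (Fin 4)) (![0, 2, 4] i) =
      ((![numeral A 2 k, Term.var 0, Term.var 1] : Fin 3 → A.L.Term (Fin 2)) i).subst
        (fun i => Term.var (![(1 : Fin 4), 3] i)) := by
    intro i; fin_cases i
    · exact (subst_numeral k _).symm
    · rfl
    · rfl
  change Fml.all (Fml.all (Fml.all (Fml.all (Fml.neg (Fml.and (Fml.and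
    ((neg.rename ![1, 2]).subst (liftSubst (liftSubst (liftSubst (liftSubst
      (fun _ : Fin 1 => numeral A 0 k))))))
    ((prf.rename ![0, 1, 3]).subst (liftSubst (liftSubst (liftSubst (liftSubst
      (fun _ : Fin 1 => numeral A 0 k)))))))
    ((prf.rename ![0, 2, 4]).subst (liftSubst (liftSubst (liftSubst (liftSubst
      (fun _ : Fin 1 => numeral A 0 k))))))))))) = _
  simp only [h0, rename_subst, h1, h2, h3]
  simp only [GenericConfiguration.consSentence, rename, instFirst, subst_subst]

theorem realize_consSentence {A : ArithLanguage} (D : Set ℕ) (neg prf : Fml A 2) :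
    (GenericConfiguration.consSentence neg prf).Realize ℕ D Fin.elim0 ↔
      ∀ x ∈ D, ∀ y ∈ D, ∀ p ∈ D, ∀ q ∈ D, ¬ ((neg.Realize ℕ D ![x, y] ∧
        prf.Realize ℕ D ![x, p]) ∧ prf.Realize ℕ D ![y, q]) := by
  simp only [GenericConfiguration.consSentence, Realize, realize_rename]
  -- The nested assignment built by the four quantifiers is read off position by position.
  have key : ∀ (x y p q : ℕ) (i j : Fin 4),
      (fun l : Fin 2 => (Fin.snoc (α := fun _ => ℕ) (Fin.snoc (α := fun _ => ℕ)
        (Fin.snoc (α := fun _ => ℕ) (Fin.snoc (α := fun _ => ℕ)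
        (Fin.elim0 : Fin 0 → ℕ) x) y) p) q : Fin 4 → ℕ) (![i, j] l)) =
      ![(![x, y, p, q] : Fin 4 → ℕ) i, (![x, y, p, q] : Fin 4 → ℕ) j] := by
    intro x y p q i j
    funext l
    fin_cases l <;> [fin_cases i; fin_cases j] <;> rfl
  refine forall₂_congr fun x _ => forall₂_congr fun y _ => forall₂_congr fun p _ =>
    forall₂_congr fun q _ => ?_
  have h1 := key x y p q 0 1
  have h2 := key x y p q 0 2
  have h3 := key x y p q 1 3
  exact iff_of_eq (by rw [h1, h2, h3]; rfl)

namespace GenericConfiguration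

variable {ξ : GenericConfiguration}

/-! ### Stability -/

/-- There is no unbounded quantifier to restrict. Hence the numerical bounds in the conclusions of
A- and E-stability are immaterial for `Δ₀` sentences. -/
theorem good_iff_trueStd {x : EReal} {φ : Sentence ξ.lang} (h : φ ∈ ξ.Δ₀ 0) :
    Good x φ ↔ φ.TrueStd :=
  (ξ.Δ₀_bounded h).realize_congr _ _ _

theorem AStable.zeroStable (h : ξ.AStable) : ξ.ZeroStable :=
  fun θ hθ Υ P hΥ hP hL => (good_iff_trueStd hΥ).1 (h θ hθ Υ P (.base hΥ) hP hL)

theorem EStable.zeroStable (h : ξ.EStable) : ξ.ZeroStable :=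
  fun θ hθ Υ P hΥ hP hL => (good_iff_trueStd hΥ).1 (h θ hθ Υ P (.base hΥ) hP hL)

/-! ### Consistency -/

/-- Injectivity of the numbering recovers the formula and the added axiom from their numbers;
monotonicity absorbs the proofs from `B` alone. -/
theorem substPrfRel_code (φ : Fml ξ.lang 1) (t p : ℕ) :
    ξ.SubstPrfRel ![ξ.code φ, t, p] ↔
      ξ.PrfRel (insert (φ.instNum (ξ.code φ)) ξ.B) ![t, p] := by
  constructor
  · rintro (⟨ψ, P, h1, h2, h3⟩ | ⟨h, ⟨ψ, h1, h2⟩, η, h3, h4⟩)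
    · exact ⟨ψ, P, h1, h2, ξ.derives_mono (Set.subset_insert _ _) h3⟩
    · obtain rfl := ξ.code_injective 1 h1
      obtain rfl := ξ.code_injective 0 (h3.trans h2.symm)
      exact h4
  · intro h
    exact Or.inr ⟨_, ⟨φ, rfl, rfl⟩, _, rfl, h⟩

theorem IsSelfConsZero.exists_eq {Φ : Sentence ξ.lang} (h : ξ.IsSelfConsZero Φ) :
    ∃ neg prf : Fml ξ.lang 2, neg.FullyBounded ∧ prf.FullyBounded ∧ neg.Defines ξ.NegRel ∧
      prf.Defines (ξ.PrfRel (insert Φ ξ.B)) ∧ Φ = consSentence neg prf := by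
  obtain ⟨-, neg, hneg, prf, hprf, hn, hp, hΦ⟩ := h
  refine ⟨neg, prf.instFirst (ξ.code (selfConsFormula neg prf)), ξ.Δ₀_bounded hneg,
    (ξ.Δ₀_bounded hprf).subst _, hn, fun v => ?_, hΦ.trans (selfConsFormula_instNum _ _ _)⟩
  refine (hp.instFirst _ v).trans ((substPrfRel_code _ _ _).trans ?_)
  -- The self-reference closes: the added axiom is `Φ` itself.
  rw [← hΦ]
  exact Iff.rfl

theorem IsSelfConsZero.statesLevelZeroConsistency {Φ : Sentence ξ.lang}
    (h : ξ.IsSelfConsZero Φ) : ξ.StatesLevelZeroConsistency (insert Φ ξ.B) Φ := by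
  obtain ⟨neg, prf, -, -, hn, hp, hΦ⟩ := h.exists_eq
  exact ⟨h.1, neg, prf, hn, hp, hΦ⟩

theorem isRView_singleton {Φ : Sentence ξ.lang} (h : IsPi1 ξ.Δ₀ Φ) : ξ.IsRView {Φ} := by
  refine ⟨by rintro φ rfl; exact h, ?_⟩
  have : ComputablePred (fun m : ℕ => m = ξ.code Φ) :=
    (PrimrecPred.computablePred (Primrec.eq.comp Primrec.id (Primrec.const _)))
  refine this.to_re.of_eq fun m => ?_
  simp [eq_comm]

/-- Explosion: `(φ ∧ ¬φ) → χ` is valid, and the indirect-implication property detaches `χ`. -/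
theorem provable_of_not_consistent {α : Set (Sentence ξ.lang)} (h : ¬ ξ.Consistent α)
    (χ : Sentence ξ.lang) : ξ.Provable α χ := by
  obtain ⟨φ, h1, h2⟩ := not_not.1 h
  refine ξ.derives_indirect h1 h2 (ξ.derives_valid ?_)
  intro M _ _ h
  exact absurd h.1 h.2

theorem exists_Log_lt (p : ℕ) : ∃ J : ℕ, ∀ K : ℕ, J ≤ K → Log p < ((K : ℝ) : EReal) := by
  unfold Log
  split_ifs with hp
  · exact ⟨0, fun K _ => EReal.bot_lt_coe _⟩
  · obtain ⟨J, hJ⟩ := exists_nat_gt (Real.logb 2 p)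
    exact ⟨J, fun K hK => EReal.coe_lt_coe_iff.2 (hJ.trans_le (by exact_mod_cast hK))⟩

theorem Log_eq_bot_of_lt_zero {p : ℕ} (h : Log p < 0) : Log p = ⊥ := by
  unfold Log at h ⊢
  split_ifs at h ⊢ with hp
  · rfl
  · exact absurd h (not_lt.2 (EReal.coe_nonneg.2
      (Real.logb_nonneg one_lt_two (by exact_mod_cast Nat.one_le_iff_ne_zero.2 hp))))

/-- If `Good(J)` holds for all smaller natural numbers, then a number below `2 ^ J` meets the
hypothesis of stability. -/
theorem Log_le_sharp_add_one {Φ : Sentence ξ.lang} {J p : ℕ}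
    (hJ : ∀ K < J, Good ((K : ℝ) : EReal) Φ) (hp : Log p < ((J : ℝ) : EReal)) :
    Log p ≤ sharp {Φ} + 1 := by
  cases J with
  -- Only the number `0` lies below `2 ^ 0`, and its logarithm `-∞` meets the bound even if `♯{Φ}`
  -- is `-∞`.
  | zero => exact (Log_eq_bot_of_lt_zero (by simpa using hp)).le.trans bot_le
  -- `Good(J - 1)` gives `♯{Φ} ≥ J - 1`; this is where the `+ 1` in the stability hypothesis is
  -- used.
  | succ K =>
    have h1 : ((K : ℝ) : EReal) ≤ sharp {Φ} :=
      le_sSup ⟨K, rfl, by rintro φ rfl; exact hJ K K.lt_succ_self⟩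
    refine hp.le.trans ?_
    calc (((K + 1 : ℕ) : ℝ) : EReal) = ((K : ℝ) : EReal) + 1 := by push_cast; rfl
      _ ≤ _ := add_le_add_left h1 1

theorem IsSelfConsZero.consistent (hξ : ξ.ZeroStable) {Φ : Sentence ξ.lang}
    (h : ξ.IsSelfConsZero Φ) : ξ.Consistent (insert Φ ξ.B) := by
  classical
  by_contra hcon
  obtain ⟨neg, prf, hneg, hprf, hn, hp, hΦ⟩ := h.exists_eq
  -- Failure of `Good(x)` amounts to a contradictory pair whose sentence and proof numbers are all
  -- below `2 ^ x`. The matrix is fully bounded, so the restriction affects only the four outer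
  -- quantifiers.
  have good : ∀ x, ¬ Good x Φ ↔ ∃ (Υ : Sentence ξ.lang) (P Q : ξ.Proof), Υ ∈ ξ.Δ₀ 0 ∧
      ξ.derives (insert Φ ξ.B) P Υ ∧ ξ.derives (insert Φ ξ.B) Q Υ.neg ∧
      Log (ξ.code Υ) < x ∧ Log (ξ.code Υ.neg) < x ∧ Log (ξ.g P) < x ∧ Log (ξ.g Q) < x := by
    intro x
    have e := realize_consSentence {v | Log v < x} neg prf
    rw [← hΦ] at e
    rw [Good, e]
    simp only [hneg.realize_congr _ Set.univ, hprf.realize_congr _ Set.univ, hn _, hp _]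
    push Not
    constructor
    · rintro ⟨x, hx, y, hy, p, hp, q, hq, ⟨⟨Υ, hΥ, rfl, rfl⟩, φ, P, h1, rfl, h2⟩,
        ψ, Q, h3, rfl, h4⟩
      obtain rfl := ξ.code_injective 0 h1
      obtain rfl := ξ.code_injective 0 h3
      exact ⟨_, P, Q, hΥ, h2, h4, hx, hy, hp, hq⟩
    · rintro ⟨Υ, P, Q, hΥ, h1, h2, hx, hy, hp, hq⟩
      exact ⟨_, hx, _, hy, _, hp, _, hq, ⟨⟨Υ, hΥ, rfl, rfl⟩, Υ, P, rfl, rfl, h1⟩,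
        Υ.neg, Q, rfl, rfl, h2⟩
  -- By explosion any `Δ₀` sentence serves, here `T_0 = T_0`; the sum of four thresholds exceeds
  -- each of them.
  have bad : ∃ J : ℕ, ¬ Good ((J : ℝ) : EReal) Φ := by
    let Υ : Sentence ξ.lang := .eq (numeral _ 0 0) (numeral _ 0 0)
    obtain ⟨P, hP⟩ := provable_of_not_consistent hcon Υ
    obtain ⟨Q, hQ⟩ := provable_of_not_consistent hcon Υ.neg
    obtain ⟨a, ha⟩ := exists_Log_lt (ξ.code Υ)
    obtain ⟨b, hb⟩ := exists_Log_lt (ξ.code Υ.neg)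
    obtain ⟨c, hc⟩ := exists_Log_lt (ξ.g P)
    obtain ⟨d, hd⟩ := exists_Log_lt (ξ.g Q)
    exact ⟨a + b + c + d, (good _).2 ⟨Υ, P, Q, ξ.Δ₀_quantifierFree trivial, hP, hQ,
      ha _ (by omega), hb _ (by omega), hc _ (by omega), hd _ (by omega)⟩⟩
  -- At the least failing `J`, only the bounds on the two proofs matter.
  obtain ⟨Υ, P, Q, hΥ, hP, hQ, -, -, hp, hq⟩ := (good _).1 (Nat.find_spec bad)
  have hmin : ∀ K < Nat.find bad, Good ((K : ℝ) : EReal) Φ :=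
    fun K hK => not_not.1 (Nat.find_min bad hK)
  rw [← Set.singleton_union] at hP hQ
  exact hξ {Φ} (isRView_singleton h.1) Υ.neg Q (ξ.Δ₀_neg hΥ) hQ (Log_le_sharp_add_one hmin hq)
    (hξ {Φ} (isRView_singleton h.1) Υ P hΥ hP (Log_le_sharp_add_one hmin hp))

/-! ### Existence -/

/-- Each clause generating the `Δ₀` relations is matched by a closure property of `Δ₀`; renaming
places the graphs of `+` and `·` at arbitrary variables. -/
theorem exists_defines {n : ℕ} {R : (Fin n → ℕ) → Prop} (h : IsDelta0Rel R) :
    ∃ φ ∈ ξ.Δ₀ n, φ.Defines R := by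
  induction h with
  | add i j k =>
    obtain ⟨φ, hφ, hd⟩ := ξ.Δ₀_add
    exact ⟨_, ξ.Δ₀_rename ![i, j, k] hφ, hd.rename _⟩
  | mul i j k =>
    obtain ⟨φ, hφ, hd⟩ := ξ.Δ₀_mul
    exact ⟨_, ξ.Δ₀_rename ![i, j, k] hφ, hd.rename _⟩
  | not _ ih =>
    obtain ⟨φ, hφ, hd⟩ := ih
    exact ⟨_, ξ.Δ₀_neg hφ, fun v => not_congr (hd v)⟩
  | and _ _ ih₁ ih₂ =>
    obtain ⟨φ, hφ, hd⟩ := ih₁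
    obtain ⟨ψ, hψ, he⟩ := ih₂
    exact ⟨_, ξ.Δ₀_and hφ hψ, fun v => and_congr (hd v) (he v)⟩
  | bex i _ ih =>
    obtain ⟨φ, hφ, hd⟩ := ih
    exact ⟨_, ξ.Δ₀_bex i hφ, fun v =>
      exists_congr fun a => and_congr (ξ.lang.le_std _) (hd _)⟩

/-- The formula `prf(t, p) ∨ ∃ h ≤ p, ∃ b ≤ p, b = a ∧ sub(b, h) ∧ exPrf(h, t, p)` in the variables
`a, t, p`.  The variable `a` occurs only in the equation. -/
def substPrfFormula {A : ArithLanguage} (prf sub : Fml A 2) (exPrf : Fml A 3) : Fml A 3 :=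
  .neg (.and (.neg (prf.rename ![1, 2])) (.neg (.bex (Term.var 2) (.bex (Term.var 2)
    (.and (.eq (Term.var 4) (Term.var 0))
      (.and (sub.rename ![(4 : Fin 5), 3]) (exPrf.rename ![(3 : Fin 5), 1, 2])))))))

/-- The variable `a` may be replaced by any term, since it occurs only in an equation. The other two
must remain variables: both reach the given formulae by renaming, and `p` also bounds the
quantifiers. -/
theorem subst_substPrfFormula_mem {prf sub : Fml ξ.lang 2} {exPrf : Fml ξ.lang 3}
    (hprf : prf ∈ ξ.Δ₀ 2) (hsub : sub ∈ ξ.Δ₀ 2) (hex : exPrf ∈ ξ.Δ₀ 3) {n : ℕ}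
    (τ : Fin 3 → ξ.lang.L.Term (Fin n)) (i j : Fin n) (hi : τ 1 = Term.var i)
    (hj : τ 2 = Term.var j) : (substPrfFormula prf sub exPrf).subst τ ∈ ξ.Δ₀ n := by
  have l1 : liftSubst (liftSubst τ) 1 = Term.var i.castSucc.castSucc := by
    have : (1 : Fin 5) = (1 : Fin 3).castSucc.castSucc := rfl
    rw [this, liftSubst_castSucc, liftSubst_castSucc, hi]; rfl
  have l2 : liftSubst (liftSubst τ) 2 = Term.var j.castSucc.castSucc := by
    have : (2 : Fin 5) = (2 : Fin 3).castSucc.castSucc := rfl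
    rw [this, liftSubst_castSucc, liftSubst_castSucc, hj]; rfl
  have l3 : liftSubst (liftSubst τ) 3 = Term.var (Fin.last n).castSucc := by
    have : (3 : Fin 5) = (Fin.last 3).castSucc := rfl
    rw [this, liftSubst_castSucc, liftSubst_last]; rfl
  have l4 : liftSubst (liftSubst τ) 4 = Term.var (Fin.last (n + 1)) := liftSubst_last _
  have l2' : liftSubst τ 2 = Term.var j.castSucc := by
    have : (2 : Fin 4) = (2 : Fin 3).castSucc := rfl
    rw [this, liftSubst_castSucc, hj]; rfl
  simp only [substPrfFormula, Fml.subst, Term.subst, rename_subst, hj, l2']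
  refine ξ.Δ₀_neg (ξ.Δ₀_and (ξ.Δ₀_neg ?_) (ξ.Δ₀_neg (ξ.Δ₀_bex _ (ξ.Δ₀_bex _
    (ξ.Δ₀_and (ξ.Δ₀_quantifierFree trivial) (ξ.Δ₀_and ?_ ?_))))))
  · convert ξ.Δ₀_rename ![i, j] hprf using 1
    refine congrArg prf.subst (funext fun l => ?_)
    fin_cases l <;> [exact hi; exact hj]
  · convert ξ.Δ₀_rename ![Fin.last (n + 1), (Fin.last n).castSucc] hsub using 1
    refine congrArg sub.subst (funext fun l => ?_)
    fin_cases l <;> [exact l4; exact l3]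
  · convert ξ.Δ₀_rename ![(Fin.last n).castSucc, i.castSucc.castSucc, j.castSucc.castSucc] hex
      using 1
    refine congrArg exPrf.subst (funext fun l => ?_)
    fin_cases l <;> [exact l3; exact l1; exact l2]

/-- A proof that really uses the added axiom `h` satisfies `h ≤ p`, and then `a ≤ h ≤ p` because
self-substitution does not lower the number. A proof that does not use it falls under the first
disjunct. -/
theorem ConventionalNumbering.substPrfRel_iff (h : ξ.ConventionalNumbering) (a t p : ℕ) :
    ξ.SubstPrfRel ![a, t, p] ↔ ξ.PrfRel ξ.B ![t, p] ∨
      ∃ h ≤ p, ∃ b ≤ p, b = a ∧ ξ.SubstRel ![b, h] ∧ ξ.ExPrfRel ![h, t, p] := by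
  constructor
  · rintro (h1 | ⟨k, ⟨φ, h1, h2⟩, η, h3, ψ, P, h4, h5, h6⟩)
    · exact Or.inl h1
    · simp only [Matrix.cons_val] at h1 h2 h3 h4 h5
      subst h1 h2 h5
      rcases h.axiom_le_proof η ψ P h6 with h7 | h7
      · exact Or.inl ⟨ψ, P, h4, rfl, h7⟩
      · rw [h3] at h7
        exact Or.inr ⟨_, h7, _, (h.formula_le_subst φ).trans h7, rfl, ⟨φ, rfl, rfl⟩,
          η, h3, ψ, P, h4, rfl, h6⟩
  · rintro (h1 | ⟨k, -, b, -, rfl, h1, h2⟩)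
    · exact Or.inl h1
    · exact Or.inr ⟨k, h1, h2⟩

theorem ConventionalNumbering.defines_substPrfFormula (h : ξ.ConventionalNumbering)
    {prf sub : Fml ξ.lang 2} {exPrf : Fml ξ.lang 3} (hprf : prf.Defines (ξ.PrfRel ξ.B))
    (hsub : sub.Defines ξ.SubstRel) (hex : exPrf.Defines ξ.ExPrfRel) :
    (substPrfFormula prf sub exPrf).Defines ξ.SubstPrfRel := by
  intro v
  obtain ⟨a, t, p, rfl⟩ : ∃ a t p, v = ![a, t, p] :=
    ⟨v 0, v 1, v 2, by funext i; fin_cases i <;> rfl⟩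
  -- The formula expresses the disjunction by negation and conjunction, the connectives under which
  -- `Δ₀` is closed.
  rw [h.substPrfRel_iff, or_iff_not_and_not]
  refine not_congr (and_congr (not_congr ?_) (not_congr (exists_congr fun k =>
    and_congr (ξ.lang.le_std _) (exists_congr fun b => and_congr (ξ.lang.le_std _)
      (and_congr Iff.rfl (and_congr ?_ ?_))))))
  · exact hprf.rename _ _
  · exact hsub.rename _ _
  · exact hex.rename _ _

/-- Membership of the numeral instances is a separate hypothesis because it does not follow from
`prf` being `Δ₀`. -/
theorem isPi1_consSentence {neg : Fml ξ.lang 2} {prf : Fml ξ.lang 3} (k : ℕ)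
    (hneg : neg ∈ ξ.Δ₀ 2) (hprf : ∀ i j : Fin 4,
      prf.subst ![numeral _ 4 k, Term.var i, Term.var j] ∈ ξ.Δ₀ 4) :
    IsPi1 ξ.Δ₀ (consSentence neg (prf.instFirst k)) := by
  have e : ∀ i j : Fin 4, (prf.instFirst k).rename ![i, j] ∈ ξ.Δ₀ 4 := by
    intro i j
    convert hprf i j using 1
    rw [instFirst, rename, subst_subst]
    refine congrArg prf.subst (funext fun l => ?_)
    fin_cases l
    · exact subst_numeral k _
    · rfl
    · rfl
  exact .all (.all (.all (.all (.base (ξ.Δ₀_neg (ξ.Δ₀_and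
    (ξ.Δ₀_and (ξ.Δ₀_rename _ hneg) (e _ _)) (e _ _)))))))

theorem ConventionalNumbering.exists_isSelfConsZero (h : ξ.ConventionalNumbering) :
    ∃ Φ, ξ.IsSelfConsZero Φ := by
  obtain ⟨neg, hneg, hn⟩ := exists_defines (ξ := ξ) h.neg_delta0
  obtain ⟨prf, hprf, hp⟩ := exists_defines (ξ := ξ) h.prf_delta0
  obtain ⟨sub, hsub, hs⟩ := exists_defines (ξ := ξ) h.subst_delta0
  obtain ⟨exPrf, hex, he⟩ := exists_defines (ξ := ξ) h.exPrf_delta0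
  have hmem : substPrfFormula prf sub exPrf ∈ ξ.Δ₀ 3 :=
    ξ.Δ₀_neg (ξ.Δ₀_and (ξ.Δ₀_neg (ξ.Δ₀_rename _ hprf)) (ξ.Δ₀_neg (ξ.Δ₀_bex _ (ξ.Δ₀_bex _
      (ξ.Δ₀_and (ξ.Δ₀_quantifierFree trivial)
        (ξ.Δ₀_and (ξ.Δ₀_rename _ hsub) (ξ.Δ₀_rename _ hex)))))))
  refine ⟨_, ?_, neg, hneg, _, hmem, hn, h.defines_substPrfFormula hp hs he, rfl⟩
  rw [selfConsFormula_instNum]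
  exact isPi1_consSentence _ hneg fun i j =>
    subst_substPrfFormula_mem hprf hsub hex _ i j rfl rfl

end GenericConfiguration

end SelfJust

theorem mainTheorem2 (ξ : SelfJust.GenericConfiguration) :
    (ξ.ConventionalNumbering → ∃ Φ, ξ.IsSelfConsZero Φ) ∧
    (ξ.AStable ∨ ξ.EStable → ξ.ZeroStable) ∧
    (ξ.ZeroStable → ∀ Φ, ξ.IsSelfConsZero Φ →
      ξ.StatesLevelZeroConsistency (insert Φ ξ.B) Φ ∧
      ξ.Consistent (insert Φ ξ.B) ∧
      ξ.SelfJustifying (insert Φ ξ.B)) := by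
  refine ⟨fun h => h.exists_isSelfConsZero, fun h => h.elim (·.zeroStable) (·.zeroStable),
    fun hξ Φ hΦ => ⟨hΦ.statesLevelZeroConsistency, hΦ.consistent hξ,
      ⟨Φ, SelfJust.GenericConfiguration.derives_axiom ξ (Set.mem_insert _ _),
        hΦ.statesLevelZeroConsistency⟩,
      hΦ.consistent hξ⟩⟩
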